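/- Let $A\in\mathbb C^{N\times N}$, $b,x_0\in\mathbb C^N$, $n\ge 1$, and let $q_1,\dots,q_n\in\mathbb C^N$ (shadow vectors). Write $v^H$ for the conjugate transpose, $v\perp w$ for $w^Hv=0$, $\sigma(A)$ for the spectrum of $A$, and for integers $k\ge1$ put $g_n(k)=\lfloor (k-1)/n\rfloor$, $r_n(k)=k-n\,g_n(k)\in\{1,\dots,n\}$, $p_k=(A^H)^{g_n(k)}q_{r_n(k)}$; put $f_i=A^Hq_i$. **Algorithm ML($n$)BiCGStabt.** Set $r_0=b-Ax_0$, $g_0=r_0$, $w_0=Ag_0$, $c_0=q_1^Hw_0$, $\omega_0=1$. For $k=1,2,\dots$ let $\alpha_k=q_{r_n(k)}^Hr_{k-1}/c_{k-1}$ and do the following. * If $r_n(k)<n$: set $x_k=x_{k-1}+\alpha_kg_{k-1}$, $r_k=r_{k-1}-\alpha_kw_{k-1}$, $z=r_k$, $g_k=0$. For $s=\max(k-n,0),\dots,g_n(k)n-1$ (in this order) set $\tilde\beta=-q_{r_n(s+1)}^Hz/c_s$, $z:=z+\tilde\beta w_s$, $g_k:=g_k+\tilde\beta g_s$. Then set $g_k:=z-\frac1{\omega_{g_n(k+1)}}g_k$.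 For $s=g_n(k)n,\dots,k-1$ (in this order) set $\beta=-f_{r_n(s+1)}^Hg_k/c_s$, $g_k:=g_k+\beta g_s$. * If $r_n(k)=n$: set $x_k=x_{k-1}+\alpha_kg_{k-1}$, $u_k=r_{k-1}-\alpha_kw_{k-1}$. If $u_k=0$, stop, with this $x_k$ and with $r_k=u_k=0$. Otherwise set $\omega_{g_n(k+1)}=(Au_k)^Hu_k/\|Au_k\|_2^2$, $x_k:=x_k+\omega_{g_n(k+1)}u_k$, $r_k=u_k-\omega_{g_n(k+1)}Au_k$, $z=r_k$, $g_k=0$. For $s=g_n(k)n,\dots,k-1$ (in this order) set $\tilde\beta=-q_{r_n(s+1)}^Hz/c_s$, $z:=z+\tilde\beta w_s$, $g_k:=g_k+\tilde\beta g_s$. Then set $g_k:=z-\frac1{\omega_{g_n(k+1)}}g_k$. * In both cases (unless stopped) set $w_k=Ag_k$, $c_k=q_{r_n(k+1)}^Hw_k$. **Proposition.** Work in exact arithmetic. Let $\nu$ be the degree of the minimal polynomial of $r_0$ with respect to $A$, i.e. of the monic polynomial $p$ of least degree with $p(A)r_0=0$. For $1\le l\le\nu$ let $$S_l=[p_1,\dots,p_l]^HA\,[r_0,Ar_0,\dots,A^{l-1}r_0],\qquad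 W_l=[p_1,\dots,p_l]^H[r_0,Ar_0,\dots,A^{l-1}r_0].$$ Assume that $\prod_{l=1}^{\nu}\det(S_l)\det(W_l)\ne0$ and that $\omega_{g_n(k+1)}\ne0$ and $1/\omega_{g_n(k+1)}\notin\sigma(A)$ for $1\le k\le\nu-1$. Then no division by zero occurs in the steps $k=1,\dots,\nu$ of the algorithm, and $Ax_\nu=b$. Moreover: (a) for $1\le k\le\nu-1$: $x_k\in x_0+\operatorname{span}\{r_0,Ar_0,\dots,A^{g_n(k+1)+k-1}r_0\}$ and $r_k=b-Ax_k\in r_0+\operatorname{span}\{Ar_0,A^2r_0,\dots,A^{g_n(k+1)+k}r_0\}$; (b) $r_k\ne0$ for $1\le k\le\nu-1$, and $r_\nu=0$; (c) for $1\le k\le\nu-1$: if $r_n(k)<n$, then $r_k\perp\operatorname{span}\{q_1,\dots,q_{r_n(k)}\}$ and $r_k\not\perp q_{r_n(k)+1}$; if $r_n(k)=n$, then $r_k\not\perp q_1$; (d) $u_k\perp\operatorname{span}\{q_1,\dots,q_n\}$ for $1\le k\le\nu$ with $r_n(k)=n$; (e) for $1\le k\le\nu-1$: if $r_n(k)<n$,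 then $Ag_k\perp\operatorname{span}\{q_1,\dots,q_{r_n(k)}\}$ and $Ag_k\not\perp q_{r_n(k)+1}$; if $r_n(k)=n$, then $Ag_k\not\perp q_1$. -/

import Mathlib

open scoped Matrix

namespace MLBiCGStabt

/-- The index function `g_n(k) = ⌊(k - 1) / n⌋`, for `k ≥ 1`. -/
def gIdx (n k : ℕ) : ℕ := (k - 1) / n

/-- The index function `r_n(k) = k - n g_n(k) ∈ {1, …, n}`, for `k ≥ 1`. -/
def rIdx (n k : ℕ) : ℕ := k - n * gIdx n k

/-- `p_k = (Aᴴ)^{g_n(k)} q_{r_n(k)}`, for `k ≥ 1`. -/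
def p {N : ℕ} (A : Matrix (Fin N) (Fin N) ℂ) (n : ℕ) (q : ℕ → Fin N → ℂ) (k : ℕ) : Fin N → ℂ :=
  (Aᴴ ^ gIdx n k) *ᵥ q (rIdx n k)

/-- The moment matrix `S_l = [p_1, …, p_l]ᴴ A [r₀, A r₀, …, A^{l-1} r₀]`
(the `l × l` leading principal submatrix of every `S_m` with `m ≥ l`). -/
def momentS {N : ℕ} (A : Matrix (Fin N) (Fin N) ℂ) (n : ℕ) (q : ℕ → Fin N → ℂ)
    (r₀ : Fin N → ℂ) (l : ℕ) : Matrix (Fin l) (Fin l) ℂ :=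
  Matrix.of fun i j => star (p A n q (i + 1)) ⬝ᵥ (A *ᵥ ((A ^ (j : ℕ)) *ᵥ r₀))

/-- The moment matrix `W_l = [p_1, …, p_l]ᴴ [r₀, A r₀, …, A^{l-1} r₀]`
(the `l × l` leading principal submatrix of every `W_m` with `m ≥ l`). -/
def momentW {N : ℕ} (A : Matrix (Fin N) (Fin N) ℂ) (n : ℕ) (q : ℕ → Fin N → ℂ)
    (r₀ : Fin N → ℂ) (l : ℕ) : Matrix (Fin l) (Fin l) ℂ :=
  Matrix.of fun i j => star (p A n q (i + 1)) ⬝ᵥ ((A ^ (j : ℕ)) *ᵥ r₀)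

/-- The degree `ν` of the minimal polynomial of the vector `v` with respect to `A`: the least
degree of a monic polynomial `f` with `f(A) v = 0`. -/
noncomputable def minpolyDegree {N : ℕ} (A : Matrix (Fin N) (Fin N) ℂ) (v : Fin N → ℂ) : ℕ :=
  sInf {d : ℕ | ∃ f : Polynomial ℂ, f.Monic ∧ f.natDegree = d ∧ Polynomial.aeval A f *ᵥ v = 0}

/-- The infimum in `minpolyDegree` is attained. -/
theorem minpolyDegree_spec {N : ℕ} (A : Matrix (Fin N) (Fin N) ℂ) (v : Fin N → ℂ) :
    ∃ f : Polynomial ℂ, f.Monic ∧ f.natDegree = minpolyDegree A v ∧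
      Polynomial.aeval A f *ᵥ v = 0 :=
  Nat.sInf_mem (s := {d : ℕ | ∃ f : Polynomial ℂ, f.Monic ∧ f.natDegree = d ∧
      Polynomial.aeval A f *ᵥ v = 0})
    ⟨_, A.charpoly, A.charpoly_monic, rfl, by rw [Matrix.aeval_self_charpoly, Matrix.zero_mulVec]⟩

/-- The memory of the algorithm. An entry with index `k` of `x, r, u, g, w, c` is assigned in step
`k` (entry `0` in the initialisation), `ω j` is assigned in step `j n`; entries that have not been
assigned are `0`. `divisors` lists every number by which the algorithm has divided so far, and
`stopped` says that it has terminated. -/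
structure State (N : ℕ) where
  x : ℕ → Fin N → ℂ
  r : ℕ → Fin N → ℂ
  u : ℕ → Fin N → ℂ
  g : ℕ → Fin N → ℂ
  w : ℕ → Fin N → ℂ
  c : ℕ → ℂ
  ω : ℕ → ℂ
  divisors : List ℂ
  stopped : Prop

/-- The initialisation of the algorithm:
`r₀ = b - A x₀`, `g₀ = r₀`, `w₀ = A g₀`, `c₀ = q₁ᴴ w₀`, `ω₀ = 1`. -/
noncomputable def init {N : ℕ} (A : Matrix (Fin N) (Fin N) ℂ) (b : Fin N → ℂ)
    (q : ℕ → Fin N → ℂ) (x₀ : Fin N → ℂ) : State N where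
  x := Function.update 0 0 x₀
  r := Function.update 0 0 (b - A *ᵥ x₀)
  u := 0
  g := Function.update 0 0 (b - A *ᵥ x₀)
  w := Function.update 0 0 (A *ᵥ (b - A *ᵥ x₀))
  c := Function.update 0 0 (star (q 1) ⬝ᵥ (A *ᵥ (b - A *ᵥ x₀)))
  ω := Function.update 0 0 1
  divisors := []
  stopped := False

/-- The loop that, starting from `(z_w, g_k) = (r_k, 0)`, for `s` in `L` computes
`β̃ = -q_{r_n(s+1)}ᴴ z_w / c_s`, `z_w := z_w + β̃ w_s`, `g_k := g_k + β̃ g_s`. -/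
noncomputable def loopQ {N : ℕ} (n : ℕ) (q : ℕ → Fin N → ℂ) (S : State N) (L : List ℕ)
    (rk : Fin N → ℂ) : (Fin N → ℂ) × (Fin N → ℂ) :=
  L.foldl
    (fun zg s =>
      let β : ℂ := -(star (q (rIdx n (s + 1))) ⬝ᵥ zg.1) / S.c s
      (zg.1 + β • S.w s, zg.2 + β • S.g s))
    (rk, 0)

/-- The loop that for `s` in `L` computes, with `f_i = Aᴴ q_i`,
`β = -f_{r_n(s+1)}ᴴ g_k / c_s`, `g_k := g_k + β g_s`. -/
noncomputable def loopF {N : ℕ} (A : Matrix (Fin N) (Fin N) ℂ) (n : ℕ) (q : ℕ → Fin N → ℂ)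
    (S : State N) (L : List ℕ) (gk : Fin N → ℂ) : Fin N → ℂ :=
  L.foldl
    (fun g s =>
      let β : ℂ := -(star (Aᴴ *ᵥ q (rIdx n (s + 1))) ⬝ᵥ g) / S.c s
      g + β • S.g s)
    gk

open Classical in
/-- Step `k ≥ 1` of ML(n)BiCGStabt. If `r_n(k) = n` and `u_k = 0`, then the algorithm stops with
the current `x_k`, whose residual is `u_k`. `List.Ico a b` is the list `a, a + 1, …, b - 1`, and
the natural number `k - n` is `max (k - n) 0`. -/
noncomputable def step {N : ℕ} (A : Matrix (Fin N) (Fin N) ℂ) (n : ℕ) (q : ℕ → Fin N → ℂ)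
    (k : ℕ) (S : State N) : State N :=
  if S.stopped then S else
  let α : ℂ := (star (q (rIdx n k)) ⬝ᵥ S.r (k - 1)) / S.c (k - 1)
  let x' := S.x (k - 1) + α • S.g (k - 1)
  let r' := S.r (k - 1) - α • S.w (k - 1)
  if rIdx n k < n then
    let zg := loopQ n q S (List.Ico (k - n) (gIdx n k * n)) r'
    let gk := loopF A n q S (List.Ico (gIdx n k * n) k)
      (zg.1 - (1 / S.ω (gIdx n (k + 1))) • zg.2)
    { x := Function.update S.x k x'
      r := Function.update S.r k r'
      u := S.u
      g := Function.update S.g k gk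
      w := Function.update S.w k (A *ᵥ gk)
      c := Function.update S.c k (star (q (rIdx n (k + 1))) ⬝ᵥ (A *ᵥ gk))
      ω := S.ω
      divisors := S.divisors ++ [S.c (k - 1)] ++ (List.Ico (k - n) (gIdx n k * n)).map S.c ++
        [S.ω (gIdx n (k + 1))] ++ (List.Ico (gIdx n k * n) k).map S.c
      stopped := False }
  else if r' = 0 then
    { S with
      x := Function.update S.x k x'
      r := Function.update S.r k r'
      u := Function.update S.u k r'
      divisors := S.divisors ++ [S.c (k - 1)]
      stopped := True }
  else
    let normSq : ℂ := ((‖WithLp.toLp 2 (A *ᵥ r')‖ ^ 2 : ℝ) : ℂ)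
    let ω' : ℂ := (star (A *ᵥ r') ⬝ᵥ r') / normSq
    let rk := -(ω' • (A *ᵥ r')) + r'
    let zg := loopQ n q S (List.Ico (gIdx n k * n) k) rk
    let gk := zg.1 - (1 / ω') • zg.2
    { x := Function.update S.x k (x' + ω' • r')
      r := Function.update S.r k rk
      u := Function.update S.u k r'
      g := Function.update S.g k gk
      w := Function.update S.w k (A *ᵥ gk)
      c := Function.update S.c k (star (q (rIdx n (k + 1))) ⬝ᵥ (A *ᵥ gk))
      ω := Function.update S.ω (gIdx n (k + 1)) ω'
      divisors := S.divisors ++ [S.c (k - 1)] ++ [normSq] ++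
        (List.Ico (gIdx n k * n) k).map S.c ++ [ω']
      stopped := False }

/-- The memory of ML(n)BiCGStabt, applied to `A x = b` with initial guess `x₀` and shadow vectors
`q 1, …, q n` (no other value of `q` is used), after the steps `1, …, k` in exact arithmetic. -/
noncomputable def run {N : ℕ} (A : Matrix (Fin N) (Fin N) ℂ) (b : Fin N → ℂ) (n : ℕ)
    (q : ℕ → Fin N → ℂ) (x₀ : Fin N → ℂ) : ℕ → State N
  | 0 => init A b q x₀
  | k + 1 => step A n q (k + 1) (run A b n q x₀ k)

/-- `v ⊥ span {q_1, …, q_m}`. -/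
def PerpSpan {N : ℕ} (q : ℕ → Fin N → ℂ) (m : ℕ) (v : Fin N → ℂ) : Prop :=
  ∀ y ∈ Submodule.span ℂ (q '' Set.Icc 1 m), star y ⬝ᵥ v = 0

end MLBiCGStabt

/-!
Every vector of the algorithm has the form `P(A) r₀` for a polynomial `P`. Behind the algorithm
there is a plain BiCG process with several left starting vectors: residual polynomials `R_k` with
`R_k(0) = 1` and `R_k(A) r₀ ⊥ p_1, …, p_k`, and direction polynomials `G_k` with
`A G_k(A) r₀ ⊥ p_1, …, p_k`, both of exact degree `k`. With the stabilizing polynomials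
`φ_j = (1 - ω_1 X) ⋯ (1 - ω_j X)` the algorithm computes `r_k = φ_{⌊k/n⌋}(A) R_k(A) r₀` and
`g_k = φ_{⌊k/n⌋}(A) G_k(A) r₀`, and `u_k = φ_{⌊(k-1)/n⌋}(A) R_k(A) r₀` when `n` divides `k`; this is
`IsStage`, proved for all `k < ν` by induction in `exists_isStage`.

The algorithm only forms inner products with `q_1, …, q_n`. By `shadow_mul`, if
`v ⊥ p_1, …, p_s`, then `q_{r_n(s+1)}ᴴ φ(A) v`, for `φ` of degree at most `g = g_n(s+1)`, is the
coefficient of `X ^ g` in `φ` times `p_{s+1}ᴴ v`. As all `ω_j` in use are nonzero, these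
coefficients of the `φ_j` are nonzero, and they cancel in the quotients `α_k, β, β̃`, which
therefore agree with the coefficients of the hidden process, the `β̃` up to the factor `-ω`
(`exists_half`, `loopQ_spec`, `loopF_spec`).

The determinants enter through `moment_ne_zero` and `moment_X_mul_ne_zero`: a nonzero polynomial of
degree at most `k` whose Krylov vector is orthogonal to `p_1, …, p_k` is not orthogonal to `p_{k+1}`
if `W_{k+1}` is nonsingular, and likewise with `S_{k+1}` for the product with `A`. Hence `α_{k+1}`
and `c_k` do not vanish for `k < ν`. At `k = ν` the same argument modulo the minimal polynomial
(`krylovEval_eq_zero`) shows that the residual is zero.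
-/

namespace MLBiCGStabt

open Polynomial

section Krylov

variable {N : ℕ} (A : Matrix (Fin N) (Fin N) ℂ) (n : ℕ) (q : ℕ → Fin N → ℂ) (r₀ : Fin N → ℂ)

/-! ### Krylov vectors as polynomials -/

/-- The Krylov vector `P(A) r₀` of a polynomial `P`, as a linear map in `P`. -/
noncomputable def krylovEval : ℂ[X] →ₗ[ℂ] (Fin N → ℂ) where
  toFun P := aeval A P *ᵥ r₀
  map_add' P Q := by rw [map_add, Matrix.add_mulVec]
  map_smul' a P := by rw [map_smul, Matrix.smul_mulVec, RingHom.id_apply]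

/-- The linear functional `P ↦ q_iᴴ P(A) r₀`. -/
noncomputable def shadow (i : ℕ) : ℂ[X] →ₗ[ℂ] ℂ where
  toFun P := star (q i) ⬝ᵥ krylovEval A r₀ P
  map_add' P Q := by rw [map_add, dotProduct_add]
  map_smul' a P := by rw [map_smul, dotProduct_smul, RingHom.id_apply]

/-- The linear functional `P ↦ p_{s+1}ᴴ P(A) r₀`, with the power of `Aᴴ` in `p_{s+1}` moved to the
polynomial. The index is shifted so that it starts at `0`. -/
noncomputable def moment (s : ℕ) : ℂ[X] →ₗ[ℂ] ℂ :=
  shadow A q r₀ (s % n + 1) ∘ₗ LinearMap.mulLeft ℂ (X ^ (s / n))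

theorem gIdx_succ (s : ℕ) : gIdx n (s + 1) = s / n := rfl

theorem rIdx_succ (s : ℕ) : rIdx n (s + 1) = s % n + 1 := by
  have := Nat.div_add_mod s n
  have h : gIdx n (s + 1) = s / n := rfl
  rw [rIdx, h]
  omega

theorem shadow_apply (i : ℕ) (P : ℂ[X]) :
    shadow A q r₀ i P = star (q i) ⬝ᵥ krylovEval A r₀ P := rfl

theorem moment_apply (s : ℕ) (P : ℂ[X]) :
    moment A n q r₀ s P = shadow A q r₀ (s % n + 1) (X ^ (s / n) * P) := rfl

theorem krylovEval_one : krylovEval A r₀ 1 = r₀ := by simp [krylovEval]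

theorem krylovEval_mul (P Q : ℂ[X]) :
    krylovEval A r₀ (P * Q) = aeval A P *ᵥ krylovEval A r₀ Q := by
  simp [krylovEval, Matrix.mulVec_mulVec]

theorem mulVec_krylovEval (P : ℂ[X]) :
    A *ᵥ krylovEval A r₀ P = krylovEval A r₀ (X * P) := by
  rw [krylovEval_mul, aeval_X]

theorem krylovEval_X_pow (j : ℕ) : krylovEval A r₀ (X ^ j) = (A ^ j) *ᵥ r₀ := by
  simp [krylovEval]

theorem star_conjTranspose_mulVec_dotProduct (M : Matrix (Fin N) (Fin N) ℂ) (y v : Fin N → ℂ) :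
    star (Mᴴ *ᵥ y) ⬝ᵥ v = star y ⬝ᵥ (M *ᵥ v) := by
  rw [Matrix.star_mulVec, Matrix.conjTranspose_conjTranspose, Matrix.dotProduct_mulVec]

theorem star_p_dotProduct_krylovEval (s : ℕ) (P : ℂ[X]) :
    star (p A n q (s + 1)) ⬝ᵥ krylovEval A r₀ P = moment A n q r₀ s P := by
  rw [p, gIdx_succ, rIdx_succ, ← Matrix.conjTranspose_pow, star_conjTranspose_mulVec_dotProduct,
    moment_apply, shadow_apply, krylovEval_mul, map_pow, aeval_X]

variable {A n q r₀}

theorem krylovEval_mem_span {P : ℂ[X]} {m : ℕ} (hP : P.natDegree ≤ m) :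
    krylovEval A r₀ P ∈ Submodule.span ℂ ((fun j : ℕ => (A ^ j) *ᵥ r₀) '' Set.Icc 0 m) := by
  rw [P.as_sum_range' (m + 1) (by omega), map_sum]
  refine Submodule.sum_mem _ fun j hj => ?_
  rw [← smul_X_eq_monomial, map_smul, krylovEval_X_pow]
  exact Submodule.smul_mem _ _ (Submodule.subset_span
    ⟨j, ⟨Nat.zero_le _, by simpa [Nat.lt_succ_iff] using hj⟩, rfl⟩)

theorem krylovEval_X_mul_mem_span {P : ℂ[X]} {m : ℕ} (hP : P.natDegree + 1 ≤ m) :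
    krylovEval A r₀ (X * P) ∈
      Submodule.span ℂ ((fun j : ℕ => (A ^ j) *ᵥ r₀) '' Set.Icc 1 m) := by
  rw [P.as_sum_range' m (by omega), Finset.mul_sum, map_sum]
  refine Submodule.sum_mem _ fun j hj => ?_
  rw [← smul_X_eq_monomial, mul_smul_comm, ← pow_succ', map_smul, krylovEval_X_pow]
  have := Finset.mem_range.1 hj
  exact Submodule.smul_mem _ _ (Submodule.subset_span ⟨j + 1, ⟨by omega, by omega⟩, rfl⟩)

/-- Of a polynomial factor of degree at most `g_n(s+1)` in front of a vector orthogonal to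
`p_1, …, p_s`, the shadow vector `q_{r_n(s+1)}` sees only the coefficient of degree `g_n(s+1)`:
lower powers of `Aᴴ` turn `q_{r_n(s+1)}` into some of these `p_t`. -/
theorem shadow_mul (hn : 1 ≤ n) {s : ℕ} {φ P : ℂ[X]} (hφ : φ.natDegree ≤ s / n)
    (hP : ∀ t < s, moment A n q r₀ t P = 0) :
    shadow A q r₀ (rIdx n (s + 1)) (φ * P) = φ.coeff (s / n) * moment A n q r₀ s P := by
  rw [rIdx_succ]
  conv_lhs => rw [φ.as_sum_range' (s / n + 1) (by omega)]
  rw [Finset.sum_mul, map_sum, Finset.sum_range_succ, Finset.sum_eq_zero, zero_add]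
  · rw [← smul_X_eq_monomial, smul_mul_assoc, map_smul, smul_eq_mul, moment_apply]
  · intro l hl
    have hl := Finset.mem_range.1 hl
    have h1 : (l * n + s % n) / n = l := by
      rw [mul_comm, Nat.mul_add_div (by omega), Nat.div_eq_of_lt (Nat.mod_lt _ (by omega)),
        add_zero]
    have h2 : (l * n + s % n) % n = s % n := by
      rw [mul_comm, Nat.mul_add_mod, Nat.mod_mod]
    have h3 : l * n + s % n < s := by
      have := Nat.div_add_mod s n
      have := Nat.mul_le_mul_left n (show l + 1 ≤ s / n from hl)
      rw [mul_comm l n]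
      rw [mul_add] at this
      omega
    have h := hP _ h3
    rw [moment_apply, h1, h2] at h
    rw [← smul_X_eq_monomial, smul_mul_assoc, map_smul, h, smul_zero]

theorem shadow_mul_eq_zero {i d m : ℕ} {φ P : ℂ[X]} (hi : 1 ≤ i) (hin : i ≤ n)
    (hm : d * n + i ≤ m) (hφ : φ.natDegree ≤ d) (hP : ∀ t < m, moment A n q r₀ t P = 0) :
    shadow A q r₀ i (φ * P) = 0 := by
  obtain ⟨e, rfl⟩ : ∃ e, i = e + 1 := ⟨i - 1, by omega⟩
  have h1 : (d * n + e) / n = d := by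
    rw [mul_comm, Nat.mul_add_div (by omega), Nat.div_eq_of_lt (by omega), add_zero]
  have h2 : (d * n + e) % n = e := by
    rw [mul_comm, Nat.mul_add_mod, Nat.mod_eq_of_lt (by omega)]
  have h := shadow_mul (A := A) (q := q) (r₀ := r₀) (n := n) (by omega) (s := d * n + e)
    (by rw [h1]; exact hφ) (fun t ht => hP t (by omega))
  rwa [rIdx_succ, h2, hP (d * n + e) (by omega), mul_zero] at h

theorem perpSpan_krylovEval {m : ℕ} {P : ℂ[X]}
    (h : ∀ i, 1 ≤ i → i ≤ m → shadow A q r₀ i P = 0) : PerpSpan q m (krylovEval A r₀ P) := by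
  intro y hy
  induction hy using Submodule.span_induction with
  | mem y hy =>
    obtain ⟨i, hi, rfl⟩ := hy
    exact h i hi.1 hi.2
  | zero => simp
  | add y z _ _ hy hz => rw [star_add, add_dotProduct, hy, hz, add_zero]
  | smul a y _ hy => rw [star_smul, smul_dotProduct, hy, smul_zero]

/-! ### Nonsingular moment matrices -/

theorem eq_zero_of_det_ne_zero {l : ℕ} {M : Matrix (Fin l) (Fin l) ℂ} (hM : M.det ≠ 0)
    (ℓ : Fin l → ℂ[X] →ₗ[ℂ] ℂ) (hℓ : ∀ i j : Fin l, M i j = ℓ i (X ^ (j : ℕ)))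
    {P : ℂ[X]} (hP : P.degree < l) (h : ∀ i, ℓ i P = 0) : P = 0 := by
  by_contra hP0
  refine hP0 ?_
  have hc : (fun j : Fin l => P.coeff j) = 0 := by
    refine Matrix.eq_zero_of_mulVec_eq_zero hM (funext fun i => ?_)
    have hs : P = ∑ j : Fin l, P.coeff j • X ^ (j : ℕ) := by
      conv_lhs => rw [as_sum_range_C_mul_X_pow' P (n := l) ((natDegree_lt_iff_degree_lt hP0).2 hP)]
      rw [Finset.sum_range]
      simp [smul_eq_C_mul]
    have := h i
    rw [hs, map_sum] at this
    rw [Pi.zero_apply, ← this]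
    simp [Matrix.mulVec, dotProduct, hℓ, mul_comm]
  ext j
  by_cases hj : j < l
  · simpa using congrFun hc ⟨j, hj⟩
  · rw [coeff_zero]
    exact coeff_eq_zero_of_degree_lt (hP.trans_le (by exact_mod_cast not_lt.1 hj))

theorem eq_zero_of_momentW {l : ℕ} (hW : (momentW A n q r₀ l).det ≠ 0) {P : ℂ[X]}
    (hP : P.degree < l) (h : ∀ t < l, moment A n q r₀ t P = 0) : P = 0 :=
  eq_zero_of_det_ne_zero hW (fun i => moment A n q r₀ i)
    (fun i j => by
      rw [momentW, Matrix.of_apply, ← krylovEval_X_pow, star_p_dotProduct_krylovEval])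
    hP fun i => h i i.2

theorem eq_zero_of_momentS {l : ℕ} (hS : (momentS A n q r₀ l).det ≠ 0) {P : ℂ[X]}
    (hP : P.degree < l) (h : ∀ t < l, moment A n q r₀ t (X * P) = 0) : P = 0 :=
  eq_zero_of_det_ne_zero hS (fun i => moment A n q r₀ i ∘ₗ LinearMap.mulLeft ℂ X)
    (fun i j => by
      rw [momentS, Matrix.of_apply, ← krylovEval_X_pow, mulVec_krylovEval,
        star_p_dotProduct_krylovEval]
      rfl)
    hP fun i => h i i.2

theorem degree_lt_succ_of_natDegree_le {P : ℂ[X]} {k : ℕ} (hP : P.natDegree ≤ k) :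
    P.degree < ((k + 1 : ℕ) : WithBot ℕ) :=
  degree_le_natDegree.trans_lt (by exact_mod_cast Nat.lt_succ_of_le hP)

theorem moment_ne_zero {k : ℕ} (hW : (momentW A n q r₀ (k + 1)).det ≠ 0) {P : ℂ[X]}
    (hP0 : P ≠ 0) (hP : P.natDegree ≤ k) (h : ∀ t < k, moment A n q r₀ t P = 0) :
    moment A n q r₀ k P ≠ 0 := fun hk =>
  hP0 <| eq_zero_of_momentW hW (degree_lt_succ_of_natDegree_le hP) fun t ht =>
    (Nat.lt_succ_iff_lt_or_eq.1 ht).elim (h t) fun e => e ▸ hk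

theorem moment_X_mul_ne_zero {k : ℕ} (hS : (momentS A n q r₀ (k + 1)).det ≠ 0) {P : ℂ[X]}
    (hP0 : P ≠ 0) (hP : P.natDegree ≤ k) (h : ∀ t < k, moment A n q r₀ t (X * P) = 0) :
    moment A n q r₀ k (X * P) ≠ 0 := fun hk =>
  hP0 <| eq_zero_of_momentS hS (degree_lt_succ_of_natDegree_le hP) fun t ht =>
    (Nat.lt_succ_iff_lt_or_eq.1 ht).elim (h t) fun e => e ▸ hk

/-- At the degree of the minimal polynomial orthogonality forces the Krylov vector to vanish: only
the remainder of `P` modulo the minimal polynomial matters, and `W_ν` is nonsingular. -/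
theorem krylovEval_eq_zero (hW : (momentW A n q r₀ (minpolyDegree A r₀)).det ≠ 0)
    {P : ℂ[X]} (h : ∀ t < minpolyDegree A r₀, moment A n q r₀ t P = 0) :
    krylovEval A r₀ P = 0 := by
  obtain ⟨f, hf, hdeg, hf0⟩ := minpolyDegree_spec A r₀
  have hev (Q : ℂ[X]) : krylovEval A r₀ (Q * f) = 0 := by
    rw [krylovEval_mul]
    exact (congrArg _ hf0).trans (Matrix.mulVec_zero _)
  have hP : P = P %ₘ f + (P /ₘ f) * f := by rw [mul_comm]; exact (modByMonic_add_div P f).symm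
  have hmod : P %ₘ f = 0 := by
    refine eq_zero_of_momentW hW ?_ fun t ht => ?_
    · rw [← hdeg, ← degree_eq_natDegree hf.ne_zero]
      exact degree_modByMonic_lt P hf
    · have := h t ht
      rwa [hP, map_add, ← star_p_dotProduct_krylovEval _ _ _ _ _ (_ * f), hev, dotProduct_zero,
        add_zero] at this
  rw [hP, hmod, zero_add, hev]

end Krylov

section Loops

variable {N : ℕ} {A : Matrix (Fin N) (Fin N) ℂ} {n : ℕ} {q : ℕ → Fin N → ℂ} {r₀ : Fin N → ℂ}

/-! ### The stabilizing polynomials -/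

/-- The stabilizing polynomial `φ_j = (1 - ω_1 X) ⋯ (1 - ω_j X)`. -/
noncomputable def stabPoly (ω : ℕ → ℂ) (j : ℕ) : ℂ[X] :=
  ∏ i ∈ Finset.range j, (1 - C (ω (i + 1)) * X)

theorem stabPoly_succ (ω : ℕ → ℂ) (j : ℕ) :
    stabPoly ω (j + 1) = (1 - C (ω (j + 1)) * X) * stabPoly ω j := by
  rw [stabPoly, Finset.prod_range_succ, mul_comm, stabPoly]

theorem natDegree_stabPoly_le (ω : ℕ → ℂ) (j : ℕ) : (stabPoly ω j).natDegree ≤ j := by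
  induction j with
  | zero => simp [stabPoly]
  | succ j ih =>
    rw [stabPoly_succ, add_comm]
    refine natDegree_mul_le_of_le ?_ ih
    exact (natDegree_sub_le _ _).trans (by
      simpa using (natDegree_C_mul_le _ X).trans natDegree_X_le)

/-! ### The two orthogonalization loops -/

/-- In the memory `T`, the entries `g_s, w_s, c_s` come from the direction polynomial `G`,
multiplied by `φ`; `G` has degree at most `s`, and `A G(A) r₀` is orthogonal to `p_1, …, p_s`, but
not to `p_{s+1}`. -/
structure IsDirection (A : Matrix (Fin N) (Fin N) ℂ) (n : ℕ) (q : ℕ → Fin N → ℂ)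
    (r₀ : Fin N → ℂ) (T : State N) (s : ℕ) (φ G : ℂ[X]) : Prop where
  g_eq : T.g s = krylovEval A r₀ (φ * G)
  w_eq : T.w s = krylovEval A r₀ (X * (φ * G))
  c_eq : T.c s = shadow A q r₀ (rIdx n (s + 1)) (X * (φ * G))
  natDegree_le : G.natDegree ≤ s
  natDegree_left_le : φ.natDegree ≤ s / n
  coeff_left_ne_zero : φ.coeff (s / n) ≠ 0
  moment_eq_zero : ∀ t < s, moment A n q r₀ t (X * G) = 0
  moment_ne_zero : moment A n q r₀ s (X * G) ≠ 0

namespace IsDirection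

variable {T : State N} {s : ℕ} {φ G : ℂ[X]}

theorem c_eq_mul (hn : 1 ≤ n) (h : IsDirection A n q r₀ T s φ G) :
    T.c s = φ.coeff (s / n) * moment A n q r₀ s (X * G) := by
  rw [h.c_eq, ← shadow_mul hn h.natDegree_left_le h.moment_eq_zero, mul_left_comm]

theorem c_ne_zero (hn : 1 ≤ n) (h : IsDirection A n q r₀ T s φ G) : T.c s ≠ 0 := by
  rw [h.c_eq_mul hn]
  exact mul_ne_zero h.coeff_left_ne_zero h.moment_ne_zero

/-- One Gram–Schmidt step against the direction `G`. -/
theorem moment_sub_eq_zero (h : IsDirection A n q r₀ T s φ G) {H : ℂ[X]}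
    (hH : ∀ t < s, moment A n q r₀ t (X * H) = 0) {t : ℕ} (ht : t < s + 1) :
    moment A n q r₀ t
      (X * (H - C (moment A n q r₀ s (X * H) / moment A n q r₀ s (X * G)) * G)) = 0 := by
  rw [mul_sub, mul_left_comm, ← smul_eq_C_mul, map_sub, map_smul, smul_eq_mul]
  rcases Nat.lt_succ_iff_lt_or_eq.1 ht with ht | rfl
  · rw [hH t ht, h.moment_eq_zero t ht, mul_zero, sub_zero]
  · rw [div_mul_cancel₀ _ h.moment_ne_zero, sub_self]

theorem natDegree_sub_C_mul_le (h : IsDirection A n q r₀ T s φ G) {H : ℂ[X]} {k : ℕ}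
    (hH : H.natDegree ≤ k) (hs : s ≤ k) (a : ℂ) : (H - C a * G).natDegree ≤ k :=
  (natDegree_sub_le _ _).trans
    (max_le hH ((natDegree_C_mul_le _ _).trans (h.natDegree_le.trans hs)))

theorem coeff_sub_C_mul (h : IsDirection A n q r₀ T s φ G) (H : ℂ[X]) {k : ℕ}
    (hs : s < k) (a : ℂ) : (H - C a * G).coeff k = H.coeff k := by
  rw [coeff_sub, coeff_C_mul, coeff_eq_zero_of_natDegree_lt (h.natDegree_le.trans_lt hs),
    mul_zero, sub_zero]

end IsDirection

/-- The loop `loopQ` performs Gram–Schmidt steps on `H`, started from `R`, although it never forms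
`A H(A) r₀`: its vector `z` corresponds to `φ (R - ω X H)`, and since `R` is already orthogonal to
the shadow directions in question, testing `z` amounts to testing `X H`. -/
theorem loopQ_spec (hn : 1 ≤ n) {T : State N} {φ R : ℂ[X]} {G : ℕ → ℂ[X]} {ω : ℂ} {k a b : ℕ}
    (hab : a ≤ b) (hbk : b ≤ k)
    (hG : ∀ s, a ≤ s → s < b → IsDirection A n q r₀ T s φ (G s))
    (hRdeg : R.natDegree ≤ k) (hR : ∀ t < k, moment A n q r₀ t R = 0)
    (hRa : ∀ t < a, moment A n q r₀ t (X * R) = 0) :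
    ∃ H : ℂ[X], H.natDegree ≤ k ∧ H.coeff k = R.coeff k ∧
      (∀ t < b, moment A n q r₀ t (X * H) = 0) ∧
      loopQ n q T (List.Ico a b) (krylovEval A r₀ ((1 - C ω * X) * φ * R)) =
        (krylovEval A r₀ (φ * (R - C ω * X * H)), krylovEval A r₀ (-C ω * φ * (H - R))) := by
  induction b, hab using Nat.le_induction with
  | base =>
    refine ⟨R, hRdeg, rfl, hRa, ?_⟩
    rw [List.Ico.self_empty, loopQ, List.foldl_nil, sub_self, mul_zero, map_zero]
    congr 2
    ring
  | succ b hab ih =>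
    obtain ⟨H, h1, h2, h3, h4⟩ := ih (by omega) fun s hs hs' => hG s hs (by omega)
    have hd := hG b hab (by omega)
    set γ := moment A n q r₀ b (X * H) / moment A n q r₀ b (X * G b) with hγ
    refine ⟨H - C γ * G b, hd.natDegree_sub_C_mul_le h1 (by omega) γ,
      (hd.coeff_sub_C_mul H (by omega) γ).trans h2, fun t ht => hd.moment_sub_eq_zero h3 ht, ?_⟩
    -- `β̃` is `ω` times the Gram–Schmidt coefficient `γ`
    have hz : -(star (q (rIdx n (b + 1))) ⬝ᵥ krylovEval A r₀ (φ * (R - C ω * X * H))) / T.c b =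
        ω * γ := by
      have hv (t : ℕ) : moment A n q r₀ t (R - C ω * X * H) =
          moment A n q r₀ t R - ω * moment A n q r₀ t (X * H) := by
        rw [mul_assoc, ← smul_eq_C_mul, map_sub, map_smul, smul_eq_mul]
      rw [← shadow_apply, shadow_mul hn hd.natDegree_left_le fun t ht => by
        rw [hv, hR t (by omega), h3 t ht, mul_zero, sub_zero], hv, hR b (by omega),
        hd.c_eq_mul hn, hγ]
      have := hd.coeff_left_ne_zero
      have := hd.moment_ne_zero
      field_simp
      ring
    rw [loopQ, List.Ico.succ_top hab, List.foldl_append, ← loopQ, h4]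
    simp only [List.foldl_cons, List.foldl_nil]
    rw [hz, hd.w_eq, hd.g_eq, ← map_smul, ← map_smul, ← map_add, ← map_add, smul_eq_C_mul,
      smul_eq_C_mul, C_mul]
    congr 2 <;> ring

/-- The loop `loopF` performs Gram–Schmidt steps on `H`. -/
theorem loopF_spec (hn : 1 ≤ n) {T : State N} {φ H₀ : ℂ[X]} {G : ℕ → ℂ[X]} {k a b : ℕ}
    (hab : a ≤ b) (hbk : b ≤ k)
    (hG : ∀ s, a ≤ s → s < b → IsDirection A n q r₀ T s φ (G s))
    (hdeg : H₀.natDegree ≤ k) (ha : ∀ t < a, moment A n q r₀ t (X * H₀) = 0) :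
    ∃ H : ℂ[X], H.natDegree ≤ k ∧ H.coeff k = H₀.coeff k ∧
      (∀ t < b, moment A n q r₀ t (X * H) = 0) ∧
      loopF A n q T (List.Ico a b) (krylovEval A r₀ (φ * H₀)) = krylovEval A r₀ (φ * H) := by
  induction b, hab using Nat.le_induction with
  | base => exact ⟨H₀, hdeg, rfl, ha, by rw [List.Ico.self_empty, loopF, List.foldl_nil]⟩
  | succ b hab ih =>
    obtain ⟨H, h1, h2, h3, h4⟩ := ih (by omega) fun s hs hs' => hG s hs (by omega)
    have hd := hG b hab (by omega)
    set γ := moment A n q r₀ b (X * H) / moment A n q r₀ b (X * G b) with hγ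
    refine ⟨H - C γ * G b, hd.natDegree_sub_C_mul_le h1 (by omega) γ,
      (hd.coeff_sub_C_mul H (by omega) γ).trans h2, fun t ht => hd.moment_sub_eq_zero h3 ht, ?_⟩
    have hz : -(star (Aᴴ *ᵥ q (rIdx n (b + 1))) ⬝ᵥ krylovEval A r₀ (φ * H)) / T.c b = -γ := by
      rw [star_conjTranspose_mulVec_dotProduct, mulVec_krylovEval, ← shadow_apply, mul_left_comm,
        shadow_mul hn hd.natDegree_left_le h3, hd.c_eq_mul hn, hγ, neg_div,
        mul_div_mul_left _ _ hd.coeff_left_ne_zero]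
    unfold loopF at h4 ⊢
    rw [List.Ico.succ_top hab, List.foldl_append, h4]
    simp only [List.foldl_cons, List.foldl_nil]
    rw [hz, hd.g_eq, ← map_smul, ← map_add, smul_eq_C_mul, C_neg]
    congr 1
    ring

theorem moment_X_mul (hn : 1 ≤ n) (t : ℕ) (P : ℂ[X]) :
    moment A n q r₀ t (X * P) = moment A n q r₀ (t + n) P := by
  rw [moment_apply, moment_apply, Nat.add_div_right _ hn, Nat.add_mod_right, pow_succ, mul_assoc]

/-- The new direction of step `k`. The first loop needs only the indices `s ≥ k - n`, as
`A R(A) r₀` is orthogonal to `p_1, …, p_{k-n}` when `R(A) r₀` is orthogonal to `p_1, …, p_k`. Its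
directions carry the factor `φ_{k/n-1}`, those of the second loop the factor `φ_{k/n}`. -/
theorem exists_direction (hn : 1 ≤ n) {T : State N} {W : ℕ → ℂ} {ω : ℂ} {R : ℂ[X]}
    {G : ℕ → ℂ[X]} {k : ℕ} (hW : k / n ≠ 0 → ω = W (k / n) ∧ ω ≠ 0)
    (hG : ∀ s < k, IsDirection A n q r₀ T s (stabPoly W (s / n)) (G s))
    (hRdeg : R.natDegree ≤ k) (hR : ∀ t < k, moment A n q r₀ t R = 0) :
    ∃ H : ℂ[X], H.natDegree ≤ k ∧ H.coeff k = R.coeff k ∧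
      (∀ t < k, moment A n q r₀ t (X * H) = 0) ∧
      let zg := loopQ n q T (List.Ico (k - n) (k / n * n))
        (krylovEval A r₀ (stabPoly W (k / n) * R))
      loopF A n q T (List.Ico (k / n * n) k) (zg.1 - (1 / ω) • zg.2) =
        krylovEval A r₀ (stabPoly W (k / n) * H) := by
  have hk1 : k / n * n ≤ k := Nat.div_mul_le_self k n
  have hk2 : k < (k / n + 1) * n := Nat.lt_mul_of_div_lt (Nat.lt_succ_self _) hn
  have hkn : ∀ s, k / n * n ≤ s → s < k → s / n = k / n := fun s hs hs' =>
    Nat.div_eq_of_lt_le hs (hs'.trans hk2)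
  have hfirst : ∃ H : ℂ[X], H.natDegree ≤ k ∧ H.coeff k = R.coeff k ∧
      (∀ t < k / n * n, moment A n q r₀ t (X * H) = 0) ∧
      (loopQ n q T (List.Ico (k - n) (k / n * n))
        (krylovEval A r₀ (stabPoly W (k / n) * R))).1 -
      (1 / ω) • (loopQ n q T (List.Ico (k - n) (k / n * n))
        (krylovEval A r₀ (stabPoly W (k / n) * R))).2 =
      krylovEval A r₀ (stabPoly W (k / n) * H) := by
    rcases hJ : k / n with _ | J
    · refine ⟨R, hRdeg, rfl, by simp, ?_⟩
      rw [List.Ico.eq_nil_of_le (by omega), loopQ, List.foldl_nil, smul_zero, sub_zero]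
    · rw [hJ] at hk1 hk2
      obtain ⟨hω, hω0⟩ := hW (by omega)
      rw [hJ] at hω
      have e1 : (J + 1) * n = J * n + n := by ring
      have e2 : (J + 1 + 1) * n = J * n + n + n := by ring
      obtain ⟨H, h1, h2, h3, h4⟩ := loopQ_spec (A := A) (q := q) (r₀ := r₀) hn (T := T)
        (φ := stabPoly W J) (R := R) (G := G) (ω := ω) (k := k) (a := k - n) (b := (J + 1) * n)
        (by omega) hk1
        (fun s hs hs' => by
          have := hG s (by omega)
          rwa [Nat.div_eq_of_lt_le (m := s) (n := n) (k := J) (by omega) (by omega)] at this)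
        hRdeg hR
        (fun t ht => by rw [moment_X_mul hn]; exact hR _ (by omega))
      refine ⟨H, h1, h2, h3, ?_⟩
      rw [stabPoly_succ, ← hω, h4, ← map_smul, ← map_sub, smul_eq_C_mul]
      congr 1
      have hC : C (1 / ω) * C ω = (1 : ℂ[X]) := by
        rw [← C_mul, one_div, inv_mul_cancel₀ hω0, C_1]
      linear_combination (stabPoly W J * (H - R)) * hC
  obtain ⟨H₀, h1, h2, h3, h4⟩ := hfirst
  obtain ⟨H, h1', h2', h3', h4'⟩ := loopF_spec (A := A) (q := q) (r₀ := r₀) hn (T := T)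
    (φ := stabPoly W (k / n)) (G := G) hk1 le_rfl
    (fun s hs hs' => by
      have := hG s hs'
      rwa [hkn s hs hs'] at this) h1 h3
  exact ⟨H, h1', h2'.trans h2, h3', by dsimp only; rw [h4, h4']⟩

end Loops

section Steps

variable {N : ℕ} {A : Matrix (Fin N) (Fin N) ℂ} {b : Fin N → ℂ} {n : ℕ} {q : ℕ → Fin N → ℂ}
  {x₀ r₀ : Fin N → ℂ}

/-! ### The memory along the run -/

theorem step_eq_of_ne {k s : ℕ} (hs : s ≠ k) (T : State N) :
    (step A n q k T).g s = T.g s ∧ (step A n q k T).w s = T.w s ∧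
      (step A n q k T).c s = T.c s := by
  simp only [step]
  split_ifs <;> simp [Function.update_of_ne hs]

theorem step_omega_eq_of_ne {k j : ℕ} (h : rIdx n k < n ∨ j ≠ gIdx n (k + 1)) (T : State N) :
    (step A n q k T).ω j = T.ω j := by
  simp only [step]
  split_ifs with h1 h2 h3
  · rfl
  · rfl
  · rfl
  · exact Function.update_of_ne (h.resolve_left h2) _ _

theorem run_eq_of_le {s k : ℕ} (hsk : s ≤ k) :
    (run A b n q x₀ k).g s = (run A b n q x₀ s).g s ∧
      (run A b n q x₀ k).w s = (run A b n q x₀ s).w s ∧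
      (run A b n q x₀ k).c s = (run A b n q x₀ s).c s := by
  induction k, hsk using Nat.le_induction with
  | base => exact ⟨rfl, rfl, rfl⟩
  | succ k hk ih =>
    obtain ⟨h1, h2, h3⟩ := step_eq_of_ne (A := A) (n := n) (q := q) (k := k + 1) (s := s)
      (by omega) (run A b n q x₀ k)
    exact ⟨h1.trans ih.1, h2.trans ih.2.1, h3.trans ih.2.2⟩

theorem succ_div_eq_of_rIdx_lt {m : ℕ} (h : rIdx n (m + 1) < n) : (m + 1) / n = m / n := by
  rw [rIdx_succ] at h
  have := Nat.div_add_mod m n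
  refine Nat.div_eq_of_lt_le ?_ ?_
  · rw [mul_comm]; omega
  · rw [add_mul, mul_comm]; omega

theorem succ_eq_of_not_rIdx_lt (hn : 1 ≤ n) {m : ℕ} (h : ¬ rIdx n (m + 1) < n) :
    m + 1 = (m / n + 1) * n := by
  rw [rIdx_succ] at h
  have := Nat.div_add_mod m n
  have := Nat.mod_lt m hn
  rw [add_mul, mul_comm]
  omega

theorem succ_div_eq_of_not_rIdx_lt (hn : 1 ≤ n) {m : ℕ} (h : ¬ rIdx n (m + 1) < n) :
    (m + 1) / n = m / n + 1 := by
  conv_lhs => rw [succ_eq_of_not_rIdx_lt hn h]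
  exact Nat.mul_div_cancel _ hn

theorem run_omega_eq_of_le (hn : 1 ≤ n) {j k : ℕ} (hjk : j * n ≤ k) :
    (run A b n q x₀ k).ω j = (run A b n q x₀ (j * n)).ω j := by
  induction k, hjk using Nat.le_induction with
  | base => rfl
  | succ k hk ih =>
    refine (step_omega_eq_of_ne ?_ _).trans ih
    refine or_iff_not_imp_left.2 fun h => ?_
    rw [gIdx_succ, succ_div_eq_of_not_rIdx_lt hn h]
    rintro rfl
    have := succ_eq_of_not_rIdx_lt hn h
    omega

/-! ### The first half of a step -/

/-- The coefficient `α_{m+1}` computed in step `m + 1`. -/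
noncomputable def stepAlpha (n : ℕ) (q : ℕ → Fin N → ℂ) (T : State N) (m : ℕ) : ℂ :=
  (star (q (rIdx n (m + 1))) ⬝ᵥ T.r m) / T.c m

/-- The iterate `x_m + α_{m+1} g_m`. -/
noncomputable def halfX (n : ℕ) (q : ℕ → Fin N → ℂ) (T : State N) (m : ℕ) : Fin N → ℂ :=
  T.x m + stepAlpha n q T m • T.g m

/-- The residual `r_m - α_{m+1} w_m`. -/
noncomputable def halfR (n : ℕ) (q : ℕ → Fin N → ℂ) (T : State N) (m : ℕ) : Fin N → ℂ :=
  T.r m - stepAlpha n q T m • T.w m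

theorem step_of_lt {T : State N} {m : ℕ} (hT : ¬ T.stopped) (h : rIdx n (m + 1) < n) :
    step A n q (m + 1) T =
      let zg := loopQ n q T (List.Ico (m + 1 - n) (m / n * n)) (halfR n q T m)
      let gk := loopF A n q T (List.Ico (m / n * n) (m + 1))
        (zg.1 - (1 / T.ω ((m + 1) / n)) • zg.2)
      { x := Function.update T.x (m + 1) (halfX n q T m)
        r := Function.update T.r (m + 1) (halfR n q T m)
        u := T.u
        g := Function.update T.g (m + 1) gk
        w := Function.update T.w (m + 1) (A *ᵥ gk)
        c := Function.update T.c (m + 1) (star (q (rIdx n (m + 2))) ⬝ᵥ (A *ᵥ gk))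
        ω := T.ω
        divisors := T.divisors ++ [T.c m] ++ (List.Ico (m + 1 - n) (m / n * n)).map T.c ++
          [T.ω ((m + 1) / n)] ++ (List.Ico (m / n * n) (m + 1)).map T.c
        stopped := False } :=
  (if_neg hT).trans (if_pos h)

theorem step_of_halfR_eq_zero {T : State N} {m : ℕ} (hT : ¬ T.stopped)
    (h : ¬ rIdx n (m + 1) < n) (h0 : halfR n q T m = 0) :
    step A n q (m + 1) T =
      { T with
        x := Function.update T.x (m + 1) (halfX n q T m)
        r := Function.update T.r (m + 1) (halfR n q T m)
        u := Function.update T.u (m + 1) (halfR n q T m)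
        divisors := T.divisors ++ [T.c m]
        stopped := True } :=
  (if_neg hT).trans ((if_neg h).trans (if_pos h0))

theorem step_of_halfR_ne_zero {T : State N} {m : ℕ} (hT : ¬ T.stopped)
    (h : ¬ rIdx n (m + 1) < n) (h0 : halfR n q T m ≠ 0) :
    step A n q (m + 1) T =
      let normSq : ℂ := ((‖WithLp.toLp 2 (A *ᵥ halfR n q T m)‖ ^ 2 : ℝ) : ℂ)
      let ω' : ℂ := (star (A *ᵥ halfR n q T m) ⬝ᵥ halfR n q T m) / normSq
      let rk := -(ω' • (A *ᵥ halfR n q T m)) + halfR n q T m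
      let zg := loopQ n q T (List.Ico (m / n * n) (m + 1)) rk
      let gk := zg.1 - (1 / ω') • zg.2
      { x := Function.update T.x (m + 1) (halfX n q T m + ω' • halfR n q T m)
        r := Function.update T.r (m + 1) rk
        u := Function.update T.u (m + 1) (halfR n q T m)
        g := Function.update T.g (m + 1) gk
        w := Function.update T.w (m + 1) (A *ᵥ gk)
        c := Function.update T.c (m + 1) (star (q (rIdx n (m + 2))) ⬝ᵥ (A *ᵥ gk))
        ω := Function.update T.ω ((m + 1) / n) ω'
        divisors := T.divisors ++ [T.c m] ++ [normSq] ++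
          (List.Ico (m / n * n) (m + 1)).map T.c ++ [ω']
        stopped := False } :=
  (if_neg hT).trans ((if_neg h).trans (if_neg h0))

/-- The memory `T` after step `k < ν`, described by the residual polynomial `R` and the direction
polynomial `G` of the underlying BiCG process: `r_k = φ_{k/n}(A) R(A) r₀` and
`g_k = φ_{k/n}(A) G(A) r₀`, where `φ_j` is formed with the parameters `W 1, …, W j`. -/
structure IsStage (A : Matrix (Fin N) (Fin N) ℂ) (b : Fin N → ℂ) (n : ℕ) (q : ℕ → Fin N → ℂ)
    (x₀ r₀ : Fin N → ℂ) (W : ℕ → ℂ) (T : State N) (k : ℕ) (R G : ℂ[X]) : Prop where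
  not_stopped : ¬ T.stopped
  natDegree_le : R.natDegree ≤ k
  coeff_zero : R.coeff 0 = 1
  coeff_ne_zero : R.coeff k ≠ 0
  moment_eq_zero : ∀ t < k, moment A n q r₀ t R = 0
  r_eq : T.r k = krylovEval A r₀ (stabPoly W (k / n) * R)
  direction : IsDirection A n q r₀ T k (stabPoly W (k / n)) G
  coeff_direction_ne_zero : G.coeff k ≠ 0
  x_eq : ∃ Y : ℂ[X], Y.natDegree ≤ k / n + k - 1 ∧ T.x k = x₀ + krylovEval A r₀ Y
  residual : T.r k = b - A *ᵥ T.x k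
  u_eq : 1 ≤ k → rIdx n k = n → T.u k = krylovEval A r₀ (stabPoly W ((k - 1) / n) * R)
  divisors_ne_zero : ∀ d ∈ T.divisors, d ≠ 0

theorem ne_zero_of_coeff_zero {R : ℂ[X]} (h : R.coeff 0 = 1) : R ≠ 0 := by
  rintro rfl
  simp at h

theorem stepAlpha_eq (hn : 1 ≤ n) {W : ℕ → ℂ} {T : State N} {m : ℕ} {R G : ℂ[X]}
    (h : IsStage A b n q x₀ r₀ W T m R G) :
    stepAlpha n q T m = moment A n q r₀ m R / moment A n q r₀ m (X * G) := by
  rw [stepAlpha, h.r_eq, ← shadow_apply, shadow_mul hn h.direction.natDegree_left_le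
    h.moment_eq_zero, h.direction.c_eq_mul hn,
    mul_div_mul_left _ _ h.direction.coeff_left_ne_zero]

/-- The first half of step `m + 1` is a BiCG step multiplied by `φ_{m/n}(A)`. The leading
coefficient of the new residual polynomial is nonzero because `W_{m+1}` is nonsingular. -/
theorem exists_half (hn : 1 ≤ n) {W : ℕ → ℂ} {T : State N} {m : ℕ} {R G : ℂ[X]}
    (hdetW : (momentW A n q r₀ (m + 1)).det ≠ 0) (h : IsStage A b n q x₀ r₀ W T m R G) :
    ∃ R' : ℂ[X], R'.natDegree ≤ m + 1 ∧ R'.coeff 0 = 1 ∧ R'.coeff (m + 1) ≠ 0 ∧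
      (∀ t < m + 1, moment A n q r₀ t R' = 0) ∧
      halfR n q T m = krylovEval A r₀ (stabPoly W (m / n) * R') ∧
      (∃ Y : ℂ[X], Y.natDegree ≤ m / n + m ∧ halfX n q T m = x₀ + krylovEval A r₀ Y) ∧
      halfR n q T m = b - A *ᵥ halfX n q T m := by
  have hα := stepAlpha_eq hn h
  set α := stepAlpha n q T m with hαdef
  have hα0 : α ≠ 0 := by
    rw [hα]
    exact div_ne_zero (moment_ne_zero hdetW (ne_zero_of_coeff_zero h.coeff_zero) h.natDegree_le
      h.moment_eq_zero) h.direction.moment_ne_zero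
  obtain ⟨Y, hY, hx⟩ := h.x_eq
  refine ⟨R - C α * (X * G), ?_, ?_, ?_, ?_, ?_, ⟨Y + C α * (stabPoly W (m / n) * G), ?_, ?_⟩, ?_⟩
  · refine (natDegree_sub_le _ _).trans (max_le (h.natDegree_le.trans (Nat.le_succ m)) ?_)
    refine (natDegree_C_mul_le _ _).trans ?_
    rw [add_comm]
    exact natDegree_mul_le_of_le natDegree_X_le h.direction.natDegree_le
  · simp [h.coeff_zero]
  · rw [coeff_sub, coeff_eq_zero_of_natDegree_lt (Nat.lt_succ_of_le h.natDegree_le), coeff_C_mul,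
      coeff_X_mul, zero_sub]
    exact neg_ne_zero.2 (mul_ne_zero hα0 h.coeff_direction_ne_zero)
  · intro t ht
    rw [← smul_eq_C_mul, map_sub, map_smul, smul_eq_mul, hα]
    rcases Nat.lt_succ_iff_lt_or_eq.1 ht with ht | rfl
    · rw [h.moment_eq_zero t ht, h.direction.moment_eq_zero t ht, mul_zero, sub_zero]
    · rw [div_mul_cancel₀ _ h.direction.moment_ne_zero, sub_self]
  · rw [halfR, ← hαdef, h.r_eq, h.direction.w_eq, ← map_smul, ← map_sub, smul_eq_C_mul]
    congr 1
    ring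
  · refine natDegree_add_le_of_degree_le (hY.trans (Nat.sub_le _ _))
      ((natDegree_C_mul_le _ _).trans ?_)
    exact natDegree_mul_le_of_le (natDegree_stabPoly_le _ _) h.direction.natDegree_le
  · rw [halfX, ← hαdef, hx, h.direction.g_eq, map_add, ← smul_eq_C_mul, map_smul, add_assoc]
  · rw [halfR, halfX, ← hαdef, h.residual, h.direction.w_eq, h.direction.g_eq, Matrix.mulVec_add,
      Matrix.mulVec_smul, mulVec_krylovEval, sub_sub]

/-! ### A complete step -/

theorem IsStage.residual_ne_zero {W : ℕ → ℂ} {T : State N} {k : ℕ} {R G : ℂ[X]} (hn : 1 ≤ n)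
    (hdetW : (momentW A n q r₀ (k + 1)).det ≠ 0) (h : IsStage A b n q x₀ r₀ W T k R G) :
    star (q (rIdx n (k + 1))) ⬝ᵥ T.r k ≠ 0 := by
  rw [h.r_eq, ← shadow_apply, shadow_mul hn h.direction.natDegree_left_le h.moment_eq_zero]
  exact mul_ne_zero h.direction.coeff_left_ne_zero (moment_ne_zero hdetW
    (ne_zero_of_coeff_zero h.coeff_zero) h.natDegree_le h.moment_eq_zero)

theorem IsStage.perpSpan_mul {W : ℕ → ℂ} {T : State N} {k : ℕ} {R G : ℂ[X]}
    (h : IsStage A b n q x₀ r₀ W T k R G) {d m : ℕ} (hm : m ≤ n) (hk : d * n + m ≤ k) :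
    PerpSpan q m (krylovEval A r₀ (stabPoly W d * R)) :=
  perpSpan_krylovEval fun _ hi him => shadow_mul_eq_zero hi (him.trans hm) (by omega)
    (natDegree_stabPoly_le W d) h.moment_eq_zero

theorem IsStage.perpSpan_mulVec_direction {W : ℕ → ℂ} {T : State N} {k : ℕ} {R G : ℂ[X]}
    (h : IsStage A b n q x₀ r₀ W T k R G) {m : ℕ} (hm : m ≤ n) (hk : k / n * n + m ≤ k) :
    PerpSpan q m (A *ᵥ T.g k) := by
  rw [h.direction.g_eq, mulVec_krylovEval, mul_left_comm]
  exact perpSpan_krylovEval fun _ hi him => shadow_mul_eq_zero hi (him.trans hm) (by omega)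
    (natDegree_stabPoly_le W _) h.direction.moment_eq_zero

theorem isStage_init (hr₀ : r₀ = b - A *ᵥ x₀) (hdetS : (momentS A n q r₀ 1).det ≠ 0)
    (W : ℕ → ℂ) : IsStage A b n q x₀ r₀ W (init A b q x₀) 0 1 1 where
  not_stopped := id
  natDegree_le := by simp
  coeff_zero := by simp
  coeff_ne_zero := by simp
  moment_eq_zero := by simp
  r_eq := by simp [init, stabPoly, krylovEval_one, hr₀]
  direction :=
    { g_eq := by simp [init, stabPoly, krylovEval_one, hr₀]
      w_eq := by rw [← mulVec_krylovEval]; simp [init, stabPoly, krylovEval_one, hr₀]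
      c_eq := by
        rw [shadow_apply, ← mulVec_krylovEval]
        simp [init, stabPoly, krylovEval_one, rIdx_succ, hr₀]
      natDegree_le := by simp
      natDegree_left_le := natDegree_stabPoly_le _ _
      coeff_left_ne_zero := by simp [stabPoly]
      moment_eq_zero := by simp
      moment_ne_zero := by
        have := moment_X_mul_ne_zero (k := 0) hdetS (P := 1) one_ne_zero (by simp) (by simp)
        exact this }
  coeff_direction_ne_zero := by simp
  x_eq := ⟨0, by simp, by simp [init]⟩
  residual := by simp [init]
  u_eq := by omega
  divisors_ne_zero := by simp [init]

/-- A step with `r_n(k) < n`. -/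
theorem isStage_step_of_lt (hn : 1 ≤ n) {W : ℕ → ℂ} {T : State N} {m : ℕ} {R : ℂ[X]}
    {G : ℕ → ℂ[X]} (hlt : rIdx n (m + 1) < n)
    (hdetW : (momentW A n q r₀ (m + 1)).det ≠ 0)
    (hdetS : (momentS A n q r₀ (m + 2)).det ≠ 0)
    (hW : T.ω (m / n) = W (m / n)) (hW0 : T.ω (m / n) ≠ 0)
    (hG : ∀ s < m + 1, IsDirection A n q r₀ T s (stabPoly W (s / n)) (G s))
    (h : IsStage A b n q x₀ r₀ W T m R (G m)) :
    ∃ R' G', IsStage A b n q x₀ r₀ W (step A n q (m + 1) T) (m + 1) R' G' := by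
  have hdiv := succ_div_eq_of_rIdx_lt hlt
  obtain ⟨R', h1, h2, h3, h4, h5, ⟨Y, h6, h7⟩, h8⟩ := exists_half hn hdetW h
  obtain ⟨H, g1, g2, g3, g4⟩ := exists_direction (A := A) (q := q) (r₀ := r₀) hn (T := T)
    (W := W) (ω := T.ω (m / n)) (R := R') (G := G) (k := m + 1)
    (fun _ => by rw [hdiv]; exact ⟨hW, hW0⟩) hG h1 h4
  rw [hdiv] at g4
  have hstep : step A n q (m + 1) T =
      { x := Function.update T.x (m + 1) (halfX n q T m)
        r := Function.update T.r (m + 1) (halfR n q T m)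
        u := T.u
        g := Function.update T.g (m + 1) (krylovEval A r₀ (stabPoly W (m / n) * H))
        w := Function.update T.w (m + 1) (A *ᵥ krylovEval A r₀ (stabPoly W (m / n) * H))
        c := Function.update T.c (m + 1)
          (star (q (rIdx n (m + 2))) ⬝ᵥ (A *ᵥ krylovEval A r₀ (stabPoly W (m / n) * H)))
        ω := T.ω
        divisors := T.divisors ++ [T.c m] ++ (List.Ico (m + 1 - n) (m / n * n)).map T.c ++
          [T.ω (m / n)] ++ (List.Ico (m / n * n) (m + 1)).map T.c
        stopped := False } := by
    rw [step_of_lt h.not_stopped hlt, hdiv, ← g4, ← h5]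
  have hc : ∀ s < m + 1, T.c s ≠ 0 := fun s hs => (hG s hs).c_ne_zero hn
  have hmn : m / n * n ≤ m := Nat.div_mul_le_self m n
  have hH0 : H ≠ 0 := by
    rintro rfl
    exact h3 (by rw [← g2, Polynomial.coeff_zero])
  refine ⟨R', H, ?_⟩
  rw [hstep]
  exact
    { not_stopped := id
      natDegree_le := h1
      coeff_zero := h2
      coeff_ne_zero := h3
      moment_eq_zero := h4
      r_eq := by simp [h5, hdiv]
      direction :=
        { g_eq := by simp [hdiv]
          w_eq := by simp [hdiv, mulVec_krylovEval]
          c_eq := by simp [hdiv, mulVec_krylovEval, shadow_apply]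
          natDegree_le := g1
          natDegree_left_le := natDegree_stabPoly_le _ _
          coeff_left_ne_zero := by
            rw [hdiv]
            exact h.direction.coeff_left_ne_zero
          moment_eq_zero := g3
          moment_ne_zero := moment_X_mul_ne_zero hdetS hH0 g1 g3 }
      coeff_direction_ne_zero := by rw [g2]; exact h3
      x_eq := ⟨Y, by rw [hdiv]; omega, by simp [h7]⟩
      residual := by simp [h8]
      u_eq := fun _ hu => by omega
      divisors_ne_zero := by
        intro d hd
        simp only [List.mem_append, List.mem_singleton, List.mem_map, List.Ico.mem] at hd
        rcases hd with (((hd | rfl) | ⟨s, hs, rfl⟩) | rfl) | ⟨s, hs, rfl⟩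
        · exact h.divisors_ne_zero d hd
        · exact hc m (by omega)
        · exact hc s (by omega)
        · exact hW0
        · exact hc s hs.2 }

/-- A step with `r_n(k) = n` that does not stop. Here `A u_k ≠ 0`, since `q_1ᴴ A u_k` is a nonzero
multiple of `p_{k+1}ᴴ R(A) r₀`, which does not vanish as `W_{k+1}` is nonsingular. -/
theorem isStage_step_of_eq (hn : 1 ≤ n) {W : ℕ → ℂ} {T : State N} {m : ℕ} {R : ℂ[X]}
    {G : ℕ → ℂ[X]} (hlt : ¬ rIdx n (m + 1) < n)
    (hdetW : (momentW A n q r₀ (m + 1)).det ≠ 0)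
    (hdetW' : (momentW A n q r₀ (m + 2)).det ≠ 0)
    (hdetS : (momentS A n q r₀ (m + 2)).det ≠ 0)
    (hW : (step A n q (m + 1) T).ω (m / n + 1) = W (m / n + 1)) (hW0 : W (m / n + 1) ≠ 0)
    (hG : ∀ s < m + 1, IsDirection A n q r₀ T s (stabPoly W (s / n)) (G s))
    (h : IsStage A b n q x₀ r₀ W T m R (G m)) :
    ∃ R' G', IsStage A b n q x₀ r₀ W (step A n q (m + 1) T) (m + 1) R' G' := by
  have hdiv := succ_div_eq_of_not_rIdx_lt hn hlt
  have hm : m + 1 - n = m / n * n := by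
    have := succ_eq_of_not_rIdx_lt hn hlt
    rw [add_mul] at this
    omega
  have hm' : (m + 1) / n * n = m + 1 := by rw [hdiv, ← succ_eq_of_not_rIdx_lt hn hlt]
  obtain ⟨R', h1, h2, h3, h4, h5, ⟨Y, h6, h7⟩, h8⟩ := exists_half hn hdetW h
  have hAu : A *ᵥ halfR n q T m ≠ 0 := by
    intro h0
    have hs := shadow_mul (A := A) (q := q) (r₀ := r₀) (n := n) hn (s := m + 1)
      (φ := X * stabPoly W (m / n)) (P := R')
      (by
        rw [hdiv, add_comm]
        exact natDegree_mul_le_of_le natDegree_X_le (natDegree_stabPoly_le _ _)) h4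
    rw [mul_assoc, shadow_apply, ← mulVec_krylovEval, ← h5, h0, dotProduct_zero, hdiv,
      coeff_X_mul] at hs
    exact mul_ne_zero h.direction.coeff_left_ne_zero
      (moment_ne_zero hdetW' (ne_zero_of_coeff_zero h2) h1 h4) hs.symm
  have hu : halfR n q T m ≠ 0 := fun h0 => hAu (by rw [h0, Matrix.mulVec_zero])
  have hnorm : ((‖WithLp.toLp 2 (A *ᵥ halfR n q T m)‖ ^ 2 : ℝ) : ℂ) ≠ 0 := by
    rw [Complex.ofReal_ne_zero]
    refine pow_ne_zero 2 (norm_ne_zero_iff.2 fun h0 => hAu ?_)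
    simpa using h0
  have hω' : W (m / n + 1) = (star (A *ᵥ halfR n q T m) ⬝ᵥ halfR n q T m) /
      ((‖WithLp.toLp 2 (A *ᵥ halfR n q T m)‖ ^ 2 : ℝ) : ℂ) := by
    rw [← hW, step_of_halfR_ne_zero h.not_stopped hlt hu, hdiv]
    exact Function.update_self _ _ _
  obtain ⟨H, g1, g2, g3, g4⟩ := exists_direction (A := A) (q := q) (r₀ := r₀) hn (T := T)
    (W := W) (ω := W (m / n + 1)) (R := R') (G := G) (k := m + 1)
    (fun _ => by rw [hdiv]; exact ⟨rfl, hW0⟩) hG h1 h4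
  rw [hm', List.Ico.self_empty] at g4
  simp only [loopF, List.foldl_nil] at g4
  rw [hdiv, hm] at g4
  have hr : -(W (m / n + 1) • (A *ᵥ halfR n q T m)) + halfR n q T m =
      krylovEval A r₀ (stabPoly W (m / n + 1) * R') := by
    rw [h5, mulVec_krylovEval, ← map_smul, ← map_neg, ← map_add, smul_eq_C_mul, stabPoly_succ]
    congr 1
    ring
  have hstep : step A n q (m + 1) T =
      { x := Function.update T.x (m + 1) (halfX n q T m + W (m / n + 1) • halfR n q T m)
        r := Function.update T.r (m + 1) (krylovEval A r₀ (stabPoly W (m / n + 1) * R'))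
        u := Function.update T.u (m + 1) (halfR n q T m)
        g := Function.update T.g (m + 1) (krylovEval A r₀ (stabPoly W (m / n + 1) * H))
        w := Function.update T.w (m + 1) (A *ᵥ krylovEval A r₀ (stabPoly W (m / n + 1) * H))
        c := Function.update T.c (m + 1)
          (star (q (rIdx n (m + 2))) ⬝ᵥ (A *ᵥ krylovEval A r₀ (stabPoly W (m / n + 1) * H)))
        ω := Function.update T.ω (m / n + 1) (W (m / n + 1))
        divisors := T.divisors ++ [T.c m] ++
          [((‖WithLp.toLp 2 (A *ᵥ halfR n q T m)‖ ^ 2 : ℝ) : ℂ)] ++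
          (List.Ico (m / n * n) (m + 1)).map T.c ++ [W (m / n + 1)]
        stopped := False } := by
    rw [step_of_halfR_ne_zero h.not_stopped hlt hu, hdiv, ← g4, ← hr, hω']
  have hc : ∀ s < m + 1, T.c s ≠ 0 := fun s hs => (hG s hs).c_ne_zero hn
  have hH0 : H ≠ 0 := by
    rintro rfl
    exact h3 (by rw [← g2, Polynomial.coeff_zero])
  refine ⟨R', H, ?_⟩
  rw [hstep]
  exact
    { not_stopped := id
      natDegree_le := h1
      coeff_zero := h2
      coeff_ne_zero := h3
      moment_eq_zero := h4
      r_eq := by simp [hdiv]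
      direction :=
        { g_eq := by simp [hdiv]
          w_eq := by simp [hdiv, mulVec_krylovEval]
          c_eq := by simp [hdiv, mulVec_krylovEval, shadow_apply]
          natDegree_le := g1
          natDegree_left_le := natDegree_stabPoly_le _ _
          coeff_left_ne_zero := by
            rw [hdiv, stabPoly_succ, sub_mul, one_mul, coeff_sub, coeff_eq_zero_of_natDegree_lt
              (Nat.lt_succ_of_le (natDegree_stabPoly_le W (m / n))), mul_assoc, coeff_C_mul,
              coeff_X_mul, zero_sub]
            exact neg_ne_zero.2 (mul_ne_zero hW0 h.direction.coeff_left_ne_zero)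
          moment_eq_zero := g3
          moment_ne_zero := moment_X_mul_ne_zero hdetS hH0 g1 g3 }
      coeff_direction_ne_zero := by rw [g2]; exact h3
      x_eq := by
        refine ⟨Y + C (W (m / n + 1)) * (stabPoly W (m / n) * R'), ?_, ?_⟩
        · refine natDegree_add_le_of_degree_le (h6.trans (by rw [hdiv]; omega))
            ((natDegree_C_mul_le _ _).trans ?_)
          refine (natDegree_mul_le_of_le (natDegree_stabPoly_le W (m / n)) h1).trans ?_
          rw [hdiv]
          omega
        · rw [map_add, ← smul_eq_C_mul, map_smul, ← h5, ← add_assoc, ← h7]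
          exact Function.update_self _ _ _
      residual := by
        simp only [Function.update_self]
        rw [← hr, Matrix.mulVec_add, Matrix.mulVec_smul, ← sub_sub, ← h8]
        abel
      u_eq := fun _ _ => by simp [h5]
      divisors_ne_zero := by
        intro d hd
        simp only [List.mem_append, List.mem_singleton, List.mem_map, List.Ico.mem] at hd
        rcases hd with (((hd | rfl) | rfl) | ⟨s, hs, rfl⟩) | rfl
        · exact h.divisors_ne_zero d hd
        · exact hc m (by omega)
        · exact hnorm
        · exact hc s hs.2
        · exact hW0 }

/-- Step `ν`: the residual polynomial is orthogonal to `p_1, …, p_ν`, so the residual vanishes. -/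
theorem step_last (hn : 1 ≤ n) {W : ℕ → ℂ} {T : State N} {m : ℕ} {R : ℂ[X]}
    {G : ℕ → ℂ[X]} (hν : minpolyDegree A r₀ = m + 1)
    (hdetW : (momentW A n q r₀ (m + 1)).det ≠ 0)
    (hW0 : T.ω (m / n) ≠ 0)
    (hG : ∀ s < m + 1, IsDirection A n q r₀ T s (stabPoly W (s / n)) (G s))
    (h : IsStage A b n q x₀ r₀ W T m R (G m)) :
    (∀ d ∈ (step A n q (m + 1) T).divisors, d ≠ 0) ∧
      A *ᵥ (step A n q (m + 1) T).x (m + 1) = b ∧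
      (step A n q (m + 1) T).r (m + 1) = 0 ∧
      (rIdx n (m + 1) = n → (step A n q (m + 1) T).u (m + 1) = 0) := by
  obtain ⟨R', -, -, -, h4, h5, -, h8⟩ := exists_half hn hdetW h
  have h0 : halfR n q T m = 0 := by
    rw [h5, krylovEval_mul, krylovEval_eq_zero (by rw [hν]; exact hdetW) (by rw [hν]; exact h4),
      Matrix.mulVec_zero]
  have hx : A *ᵥ halfX n q T m = b := by
    rw [h0] at h8
    exact (sub_eq_zero.1 h8.symm).symm
  have hc : ∀ s < m + 1, T.c s ≠ 0 := fun s hs => (hG s hs).c_ne_zero hn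
  have hmn : m / n * n ≤ m := Nat.div_mul_le_self m n
  by_cases hlt : rIdx n (m + 1) < n
  · have hdiv := succ_div_eq_of_rIdx_lt hlt
    rw [step_of_lt h.not_stopped hlt]
    simp only [Function.update_self]
    refine ⟨?_, hx, h0, fun hu => by omega⟩
    intro d hd
    rw [hdiv] at hd
    simp only [List.mem_append, List.mem_singleton, List.mem_map, List.Ico.mem] at hd
    rcases hd with (((hd | rfl) | ⟨s, hs, rfl⟩) | rfl) | ⟨s, hs, rfl⟩
    · exact h.divisors_ne_zero d hd
    · exact hc m (by omega)
    · exact hc s (by omega)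
    · exact hW0
    · exact hc s hs.2
  · rw [step_of_halfR_eq_zero h.not_stopped hlt h0]
    simp only [Function.update_self]
    refine ⟨?_, hx, h0, fun _ => h0⟩
    intro d hd
    simp only [List.mem_append, List.mem_singleton] at hd
    rcases hd with hd | rfl
    · exact h.divisors_ne_zero d hd
    · exact hc m (by omega)

/-! ### Induction over the steps -/

theorem IsDirection.congr {T T' : State N} {s : ℕ} {φ G : ℂ[X]}
    (h : IsDirection A n q r₀ T s φ G)
    (e : T'.g s = T.g s ∧ T'.w s = T.w s ∧ T'.c s = T.c s) :
    IsDirection A n q r₀ T' s φ G :=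
  { h with
    g_eq := e.1.trans h.g_eq
    w_eq := e.2.1.trans h.w_eq
    c_eq := e.2.2.trans h.c_eq }

/-- The final value of `ω_j`, assigned in step `j n`. -/
noncomputable def runOmega (A : Matrix (Fin N) (Fin N) ℂ) (b : Fin N → ℂ) (n : ℕ)
    (q : ℕ → Fin N → ℂ) (x₀ : Fin N → ℂ) (j : ℕ) : ℂ :=
  (run A b n q x₀ (j * n)).ω j

theorem exists_isStage (hn : 1 ≤ n) (hr₀ : r₀ = b - A *ᵥ x₀) {ν : ℕ}
    (hdetS : ∀ l, 1 ≤ l → l ≤ ν → (momentS A n q r₀ l).det ≠ 0)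
    (hdetW : ∀ l, 1 ≤ l → l ≤ ν → (momentW A n q r₀ l).det ≠ 0)
    (hW : ∀ j, j * n < ν → runOmega A b n q x₀ j ≠ 0) {k : ℕ} (hk : k < ν) :
    ∃ R G, IsStage A b n q x₀ r₀ (runOmega A b n q x₀) (run A b n q x₀ k) k R G := by
  induction k using Nat.strong_induction_on with
  | _ k ih =>
    rcases k with _ | m
    · exact ⟨1, 1, isStage_init hr₀ (hdetS 1 le_rfl hk) _⟩
    · choose! R G h using fun s (hs : s < m + 1) => ih s hs (by omega)
      have hG : ∀ s < m + 1, IsDirection A n q r₀ (run A b n q x₀ m) s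
          (stabPoly (runOmega A b n q x₀) (s / n)) (G s) := fun s hs =>
        (h s hs).direction.congr (run_eq_of_le (by omega))
      have hmn : m / n * n ≤ m := Nat.div_mul_le_self m n
      by_cases hlt : rIdx n (m + 1) < n
      · have hω : (run A b n q x₀ m).ω (m / n) = runOmega A b n q x₀ (m / n) :=
          run_omega_eq_of_le hn hmn
        exact isStage_step_of_lt hn hlt (hdetW _ (by omega) (by omega))
          (hdetS _ (by omega) (by omega)) hω (by rw [hω]; exact hW _ (by omega)) hG
          (h m (by omega))
      · have hm := succ_eq_of_not_rIdx_lt hn hlt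
        exact isStage_step_of_eq hn hlt (hdetW _ (by omega) (by omega))
          (hdetW _ (by omega) (by omega)) (hdetS _ (by omega) (by omega))
          (by rw [runOmega, ← hm]; rfl) (hW _ (by omega)) hG (h m (by omega))

end Steps

end MLBiCGStabt

/-! ### The convergence theorem -/

open MLBiCGStabt

theorem mainTheorem1 {N : ℕ} (A : Matrix (Fin N) (Fin N) ℂ) (b x₀ : Fin N → ℂ)
    (n : ℕ) (hn : 1 ≤ n) (q : ℕ → Fin N → ℂ)
    (r₀ : Fin N → ℂ) (hr₀ : r₀ = b - A *ᵥ x₀)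
    (ν : ℕ) (hν : ν = MLBiCGStabt.minpolyDegree A r₀)
    (S : ℕ → MLBiCGStabt.State N) (hS : S = MLBiCGStabt.run A b n q x₀)
    (hdet : ∏ l ∈ Finset.Icc 1 ν,
      (MLBiCGStabt.momentS A n q r₀ l).det * (MLBiCGStabt.momentW A n q r₀ l).det ≠ 0)
    (hω : ∀ k, 1 ≤ k → k ≤ ν - 1 →
      (S k).ω (MLBiCGStabt.gIdx n (k + 1)) ≠ 0 ∧
      1 / (S k).ω (MLBiCGStabt.gIdx n (k + 1)) ∉ spectrum ℂ A) :
    -- no division by zero in the steps `1, …, ν`, and `x_ν` is an exact solution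
    (∀ d ∈ (S ν).divisors, d ≠ 0) ∧
    A *ᵥ (S ν).x ν = b ∧
    -- shifted Krylov spaces, and `r_k` is the true residual
    (∀ k, 1 ≤ k → k ≤ ν - 1 →
      (S k).x k - x₀ ∈ Submodule.span ℂ
        ((fun j : ℕ => (A ^ j) *ᵥ r₀) '' Set.Icc 0 (MLBiCGStabt.gIdx n (k + 1) + k - 1)) ∧
      (S k).r k = b - A *ᵥ (S k).x k ∧
      (S k).r k - r₀ ∈ Submodule.span ℂ
        ((fun j : ℕ => (A ^ j) *ᵥ r₀) '' Set.Icc 1 (MLBiCGStabt.gIdx n (k + 1) + k))) ∧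
    -- the residual vanishes first at `k = ν`
    (∀ k, 1 ≤ k → k ≤ ν - 1 → (S k).r k ≠ 0) ∧
    (S ν).r ν = 0 ∧
    -- `r_k` against the shadow vectors
    (∀ k, 1 ≤ k → k ≤ ν - 1 → MLBiCGStabt.rIdx n k < n →
      MLBiCGStabt.PerpSpan q (MLBiCGStabt.rIdx n k) ((S k).r k) ∧
      star (q (MLBiCGStabt.rIdx n k + 1)) ⬝ᵥ (S k).r k ≠ 0) ∧
    (∀ k, 1 ≤ k → k ≤ ν - 1 → MLBiCGStabt.rIdx n k = n →
      star (q 1) ⬝ᵥ (S k).r k ≠ 0) ∧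
    -- `u_k` against the shadow vectors
    (∀ k, 1 ≤ k → k ≤ ν → MLBiCGStabt.rIdx n k = n →
      MLBiCGStabt.PerpSpan q n ((S k).u k)) ∧
    -- `A g_k` against the shadow vectors
    (∀ k, 1 ≤ k → k ≤ ν - 1 → MLBiCGStabt.rIdx n k < n →
      MLBiCGStabt.PerpSpan q (MLBiCGStabt.rIdx n k) (A *ᵥ (S k).g k) ∧
      star (q (MLBiCGStabt.rIdx n k + 1)) ⬝ᵥ (A *ᵥ (S k).g k) ≠ 0) ∧
    (∀ k, 1 ≤ k → k ≤ ν - 1 → MLBiCGStabt.rIdx n k = n →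
      star (q 1) ⬝ᵥ (A *ᵥ (S k).g k) ≠ 0) := by
  subst hS
  have hdet' : ∀ l, 1 ≤ l → l ≤ ν →
      (momentS A n q r₀ l).det ≠ 0 ∧ (momentW A n q r₀ l).det ≠ 0 := fun l h1 h2 =>
    mul_ne_zero_iff.1 (Finset.prod_ne_zero_iff.1 hdet l (Finset.mem_Icc.2 ⟨h1, h2⟩))
  have hW : ∀ j, j * n < ν → runOmega A b n q x₀ j ≠ 0 := by
    intro j hj
    rcases Nat.eq_zero_or_pos j with rfl | hj0
    · -- the initial value `ω₀ = 1`
      simp [runOmega, run, init]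
    · have hjn : 1 ≤ j * n := Nat.mul_pos hj0 hn
      have := (hω (j * n) hjn (by omega)).1
      rwa [gIdx_succ, Nat.mul_div_cancel _ hn] at this
  have stage : ∀ k, k < ν →
      ∃ R G, IsStage A b n q x₀ r₀ (runOmega A b n q x₀) (run A b n q x₀ k) k R G :=
    fun k hk => exists_isStage hn hr₀ (fun l h1 h2 => (hdet' l h1 h2).1)
      (fun l h1 h2 => (hdet' l h1 h2).2) hW hk
  have hrIdx : ∀ k, 1 ≤ k → rIdx n k < n →
      rIdx n (k + 1) = rIdx n k + 1 ∧ k / n * n + rIdx n k ≤ k := by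
    intro k hk hlt
    obtain ⟨m, rfl⟩ : ∃ m, k = m + 1 := ⟨k - 1, by omega⟩
    have hdiv := succ_div_eq_of_rIdx_lt hlt
    have h1 := Nat.div_add_mod m n
    have h2 := Nat.div_add_mod (m + 1) n
    rw [hdiv] at h2 ⊢
    rw [rIdx_succ, rIdx_succ, mul_comm]
    omega
  have hrIdx' : ∀ k, 1 ≤ k → rIdx n k = n → rIdx n (k + 1) = 1 ∧ (k - 1) / n * n + n = k := by
    intro k hk heq
    obtain ⟨m, rfl⟩ : ∃ m, k = m + 1 := ⟨k - 1, by omega⟩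
    have hm := succ_eq_of_not_rIdx_lt hn (m := m) (by omega)
    rw [rIdx_succ]
    refine ⟨?_, ?_⟩
    · rw [hm, Nat.mul_mod_left]
    · rw [Nat.add_sub_cancel, ← Nat.succ_mul]
      exact hm.symm
  have last : (∀ d ∈ (run A b n q x₀ ν).divisors, d ≠ 0) ∧
      A *ᵥ (run A b n q x₀ ν).x ν = b ∧ (run A b n q x₀ ν).r ν = 0 ∧
      (1 ≤ ν → rIdx n ν = n → (run A b n q x₀ ν).u ν = 0) := by
    rcases ν with _ | m
    · -- the minimal polynomial of `r₀` is `1`, so `r₀ = 0`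
      have h0 : r₀ = 0 := by
        obtain ⟨f, hf, hdeg, hf0⟩ := minpolyDegree_spec A r₀
        rw [hf.natDegree_eq_zero.1 (hdeg.trans hν.symm), map_one, Matrix.one_mulVec] at hf0
        exact hf0
      rw [h0] at hr₀
      refine ⟨by simp [run, init], ?_, ?_, fun h => by omega⟩
      · simpa [run, init] using (sub_eq_zero.1 hr₀.symm).symm
      · simpa [run, init] using hr₀.symm
    · choose! R G h using stage
      have hmn : m / n * n ≤ m := Nat.div_mul_le_self m n
      obtain ⟨h1, h2, h3, h4⟩ := step_last hn (G := G) hν.symm (hdet' _ (by omega) le_rfl).2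
        (by rw [run_omega_eq_of_le hn hmn]; exact hW _ (by omega))
        (fun s hs => (h s hs).direction.congr (run_eq_of_le (by omega))) (h m (by omega))
      exact ⟨h1, h2, h3, fun _ => h4⟩
  have hr : ∀ k, 1 ≤ k → k ≤ ν - 1 →
      star (q (rIdx n (k + 1))) ⬝ᵥ (run A b n q x₀ k).r k ≠ 0 := by
    intro k h1 hk
    obtain ⟨R, G, h⟩ := stage k (by omega)
    exact h.residual_ne_zero hn (hdet' _ (by omega) (by omega)).2
  have hg : ∀ k, 1 ≤ k → k ≤ ν - 1 →
      star (q (rIdx n (k + 1))) ⬝ᵥ (A *ᵥ (run A b n q x₀ k).g k) ≠ 0 := by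
    intro k h1 hk
    obtain ⟨R, G, h⟩ := stage k (by omega)
    have := h.direction.c_ne_zero hn
    rwa [h.direction.c_eq, shadow_apply, ← mulVec_krylovEval, ← h.direction.g_eq] at this
  refine ⟨last.1, last.2.1, ?_, ?_, last.2.2.1, ?_, ?_, ?_, ?_, ?_⟩
  · intro k h1 hk
    obtain ⟨R, G, h⟩ := stage k (by omega)
    obtain ⟨Y, hY, hx⟩ := h.x_eq
    rw [gIdx_succ]
    refine ⟨?_, h.residual, ?_⟩
    · rw [hx, add_sub_cancel_left]
      exact krylovEval_mem_span hY
    · have : (run A b n q x₀ k).r k - r₀ = -krylovEval A r₀ (Polynomial.X * Y) := by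
        rw [h.residual, hx, Matrix.mulVec_add, mulVec_krylovEval, ← sub_sub, ← hr₀]
        abel
      rw [this]
      exact Submodule.neg_mem _ (krylovEval_X_mul_mem_span (by
        revert hY
        generalize k / n = j
        omega))
  · intro k h1 hk h0
    exact hr k h1 hk (by rw [h0, dotProduct_zero])
  · intro k h1 hk hlt
    obtain ⟨R, G, h⟩ := stage k (by omega)
    obtain ⟨e1, e2⟩ := hrIdx k h1 hlt
    refine ⟨?_, e1 ▸ hr k h1 hk⟩
    rw [h.r_eq]
    exact h.perpSpan_mul hlt.le e2
  · intro k h1 hk heq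
    exact (hrIdx' k h1 heq).1 ▸ hr k h1 hk
  · intro k h1 hk heq
    rcases hk.lt_or_eq with hk | rfl
    · obtain ⟨R, G, h⟩ := stage k hk
      rw [h.u_eq h1 heq]
      exact h.perpSpan_mul le_rfl (hrIdx' k h1 heq).2.le
    · intro y _
      rw [last.2.2.2 h1 heq, dotProduct_zero]
  · intro k h1 hk hlt
    obtain ⟨R, G, h⟩ := stage k (by omega)
    obtain ⟨e1, e2⟩ := hrIdx k h1 hlt
    exact ⟨h.perpSpan_mulVec_direction hlt.le e2, e1 ▸ hg k h1 hk⟩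
  · intro k h1 hk heq
    exact (hrIdx' k h1 heq).1 ▸ hg k h1 hk
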